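/- Let $n_w\in\mathbb{N}$, and let $w$ be a random vector in $\mathbb{R}^{n_w}$ with $\mathbb{E}\{w\}=0$ and finite second moments, and let $\Sigma=\mathbb{E}\{ww^\top\}$. Let $\sigma\ge 0$ and suppose that the normalized vector $\xi=\Sigma^{-1/2}w$ is sub-Gaussian with variance proxy $\sigma^2$: for every unit vector $u\in\mathbb{R}^{n_w}$, $\mathbb{E}\{u^\top\xi\}=0$ and $\mathbb{E}\{e^{\lambda u^\top\xi}\}\le e^{\sigma^2\lambda^2/2}$ for all $\lambda\in\mathbb{R}$. (If $\Sigma$ is singular, $\Sigma^{-1/2}$ denotes the positive semidefinite square root of the Moore-Penrose inverse of $\Sigma$.) Let $\hat w^1,\dots,\hat w^{N_s}$ be i.i.d. samples with the distribution of $w$, and let $\hat\Sigma=N_s^{-1}\sum_{i=1}^{N_s}\hat w^i(\hat w^i)^\top$. Let $\epsilon\in(0,\tfrac12)$, $\beta\in(0,1)$, and define \[c_1=\frac{\sigma^2}{1-2\epsilon},\qquad c_2(\beta)=n_w\log\Big(1+\frac{2}{\epsilon}\Big)+\log\frac{2}{\beta},\qquad \gamma(N_s,\beta)=c_1\left(\sqrt{\frac{32\,c_2(\beta)}{N_s}}+\frac{2\,c_2(\beta)}{N_s}\right),\]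 \[B=2c_1\,c_2(\beta/2)\left(8c_1+4\sqrt{4c_1^2+c_1}+1\right).\] If $N_s\in\mathbb{N}$ satisfies $N_s\ge\lceil B\rceil$ and $N_s\ne B$ (the second condition matters only if $B$ is an integer), then $\gamma(N_s,\beta/2)<1$, and with probability at least $1-\beta$ \[\Sigma\le\frac{1}{1-\gamma(N_s,\beta/2)}\,\hat\Sigma\] in the Loewner order (that is, the right-hand side minus the left-hand side is positive semidefinite). -/

import Mathlib

open MeasureTheory ProbabilityTheory
open scoped MatrixOrder NNReal

noncomputable section

namespace SubGaussianCovariance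

/-- A real random variable `X` is sub-Gaussian with variance proxy `s` (for `s = σ²`): it has mean
zero, `exp (t X)` is integrable and `E exp (t X) ≤ exp (s t² / 2)` for every real `t`. -/
def IsSubG {Ω : Type*} [MeasurableSpace Ω] (X : Ω → ℝ) (s : ℝ≥0) (μ : Measure Ω) : Prop :=
  ∫ ω, X ω ∂μ = 0 ∧ HasSubgaussianMGF X s μ

/-- A random vector is sub-Gaussian with variance proxy `s` if its component along every
Euclidean unit vector is. -/
def IsSubGVec {Ω : Type*} [MeasurableSpace Ω] {n : ℕ} (ξ : Ω → Fin n → ℝ) (s : ℝ≥0)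
    (μ : Measure Ω) : Prop :=
  ∀ u : Fin n → ℝ, u ⬝ᵥ u = 1 → IsSubG (fun ω => u ⬝ᵥ ξ ω) s μ

/-- The second-moment matrix `E[w wᵀ]`. -/
def secondMoment {Ω : Type*} [MeasurableSpace Ω] {n : ℕ} (w : Ω → Fin n → ℝ) (μ : Measure Ω) :
    Matrix (Fin n) (Fin n) ℝ :=
  Matrix.of fun i j => ∫ ω, w ω i * w ω j ∂μ

/-- The inverse square root `S^{-1/2}` of a symmetric positive semidefinite matrix, through the
functional calculus. As `(√0)⁻¹ = 0`, it is the inverse square root of the Moore-Penrose inverse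
when `S` is singular; it is the usual `S^{-1/2}` when `S` is positive definite. -/
def invSqrt {n : ℕ} (S : Matrix (Fin n) (Fin n) ℝ) : Matrix (Fin n) (Fin n) ℝ :=
  cfc (fun x : ℝ => (Real.sqrt x)⁻¹) S

/-- The empirical second-moment matrix `N⁻¹ ∑ xᵢ xᵢᵀ` of a sample `x₁, …, x_N`. -/
def empiricalCov {n N : ℕ} (x : Fin N → Fin n → ℝ) : Matrix (Fin n) (Fin n) ℝ :=
  (N : ℝ)⁻¹ • ∑ i, Matrix.vecMulVec (x i) (x i)

/-- `c₁(σ, ε) = σ² / (1 - 2ε)`. -/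
def c₁ (σ ε : ℝ) : ℝ := σ ^ 2 / (1 - 2 * ε)

/-- `c₂(β, ε, n) = n log (1 + 2/ε) + log (2/β)`. -/
def c₂ (β ε : ℝ) (n : ℕ) : ℝ := n * Real.log (1 + 2 / ε) + Real.log (2 / β)

/-- `γ(N, β) = c₁ (√(32 c₂(β) / N) + 2 c₂(β) / N)`. -/
def γ (σ ε : ℝ) (n N : ℕ) (β : ℝ) : ℝ :=
  c₁ σ ε * (Real.sqrt (32 * c₂ β ε n / N) + 2 * c₂ β ε n / N)

/-- The sample size threshold `2 a b (8 a + 4 √(4 a² + a) + 1)`, used with `a = c₁` and `b = c₂`. -/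
def sampleBound (a b : ℝ) : ℝ :=
  2 * a * b * (8 * a + 4 * Real.sqrt (4 * a ^ 2 + a) + 1)

end SubGaussianCovariance

end

/-! Put `A = Σ^{-1/2}`, and let `D` be the second moment `AΣA` of `ξ` minus the empirical second
moment of the whitened samples. If `|yᵀDy| ≤ γ yᵀy` for all `y`, then `y = Σ^{1/2} v` gives `(1 - γ)
vᵀΣv ≤ vᵀΣ̂v`, the Loewner bound (`le_smul_empiricalCov_of_net`). A singular `Σ` is harmless:
`Σ^{1/2}A` is the projection onto the range of `Σ`, where `w` lies almost surely
(`ae_sqrt_mulVec_invSqrt_mulVec`).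

Up to a factor `1 / (1 - 2ε)`, the form of `D` need only be bounded on an `ε`-net of the sphere
(`abs_quadratic_le_of_net`), and a volume argument gives a net of at most `(1 + 2/ε)^n` points. For
a fixed unit `u` and `σ > 0`, `(uᵀξ)² / (2σ²)` has tail `2 exp (-t)`, so its centering is sub-gamma
(`mgf_centered_le_of_tail`) and Bernstein's inequality controls its empirical mean
(`measure_sq_deviation_le`). A union bound with `t = c₂(β/2)` finishes the proof. -/

namespace SubGaussianCovariance

/-! ### Exponential moments from an exponential tail -/

section Tail

variable {Ω : Type*} [MeasurableSpace Ω] {μ : Measure Ω} [IsProbabilityMeasure μ]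

lemma exp_taylor_nonneg (x : ℝ) : 0 ≤ Real.exp x - 1 - x := by
  linarith [Real.add_one_le_exp x]

/-- This is `x ≤ sinh x`. It reduces negative exponents `b` to `|b|`. -/
lemma exp_neg_taylor_le {x : ℝ} (hx : 0 ≤ x) :
    Real.exp (-x) - 1 + x ≤ Real.exp x - 1 - x := by
  have h := Real.self_le_sinh_iff.2 hx
  rw [Real.sinh_eq] at h
  linarith

lemma integral_exp_mul_sub_one (a y : ℝ) :
    ∫ t in (0 : ℝ)..y, a * (Real.exp (a * t) - 1) = Real.exp (a * y) - 1 - a * y := by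
  have h : ∀ t ∈ Set.uIcc 0 y,
      HasDerivAt (fun t => Real.exp (a * t) - a * t) (a * (Real.exp (a * t) - 1)) t := by
    intro t _
    have h1 : HasDerivAt (fun t : ℝ => a * t) a t := by
      simpa using (hasDerivAt_id t).const_mul a
    exact (h1.exp.sub h1).congr_deriv (by ring)
  rw [intervalIntegral.integral_eq_sub_of_hasDerivAt h
    ((by fun_prop : Continuous fun t => a * (Real.exp (a * t) - 1)).intervalIntegrable _ _)]
  simp; ring

/-- Layer-cake formula: the tail bound leaves `2a ∫ (e^{-(1-a)t} - e^{-t}) dt = 2a (1/(1-a) - 1)`.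
Working with the lower integral lets integrability be a consequence. -/
lemma lintegral_exp_taylor_le {Y : Ω → ℝ} (hYm : AEMeasurable Y μ) (hY0 : ∀ ω, 0 ≤ Y ω)
    (htail : ∀ t, 0 < t → μ.real {ω | t ≤ Y ω} ≤ 2 * Real.exp (-t))
    {a : ℝ} (ha0 : 0 ≤ a) (ha1 : a < 1) :
    ∫⁻ ω, ENNReal.ofReal (Real.exp (a * Y ω) - 1 - a * Y ω) ∂μ
      ≤ ENNReal.ofReal (2 * a ^ 2 / (1 - a)) := by
  have hlc := lintegral_comp_eq_lintegral_meas_le_mul μ (f := Y)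
    (g := fun t => a * (Real.exp (a * t) - 1)) (Filter.Eventually.of_forall hY0) hYm
    (fun t _ => (by fun_prop : Continuous fun t => a * (Real.exp (a * t) - 1)).intervalIntegrable
      _ _)
    ((ae_restrict_iff' measurableSet_Ioi).2 (Filter.Eventually.of_forall fun t ht =>
      mul_nonneg ha0 (sub_nonneg.2 (Real.one_le_exp (mul_nonneg ha0 (le_of_lt ht))))))
  simp only [integral_exp_mul_sub_one] at hlc
  rw [hlc]
  have hb : ∀ t ∈ Set.Ioi (0 : ℝ),
      μ {ω | t ≤ Y ω} * ENNReal.ofReal (a * (Real.exp (a * t) - 1)) ≤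
        ENNReal.ofReal (2 * a * (Real.exp (-(1 - a) * t) - Real.exp (-1 * t))) := by
    intro t ht
    have h1 : 0 ≤ a * (Real.exp (a * t) - 1) :=
      mul_nonneg ha0 (sub_nonneg.2 (Real.one_le_exp (mul_nonneg ha0 (le_of_lt ht))))
    rw [← ofReal_measureReal, ← ENNReal.ofReal_mul measureReal_nonneg]
    apply ENNReal.ofReal_le_ofReal
    calc μ.real {ω | t ≤ Y ω} * (a * (Real.exp (a * t) - 1))
        ≤ 2 * Real.exp (-t) * (a * (Real.exp (a * t) - 1)) := by gcongr; exact htail t ht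
      _ = 2 * a * (Real.exp (-t) * Real.exp (a * t) - Real.exp (-t)) := by ring
      _ = _ := by rw [← Real.exp_add]; ring_nf
  refine (setLIntegral_mono' measurableSet_Ioi hb).trans ?_
  have hi1 : IntegrableOn (fun t : ℝ => Real.exp (-(1 - a) * t)) (Set.Ioi 0) :=
    integrableOn_exp_mul_Ioi (by linarith) 0
  have hi2 : IntegrableOn (fun t : ℝ => Real.exp (-1 * t)) (Set.Ioi 0) :=
    integrableOn_exp_mul_Ioi (by norm_num) 0
  have hi : IntegrableOn (fun t : ℝ => 2 * a * (Real.exp (-(1 - a) * t) - Real.exp (-1 * t)))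
      (Set.Ioi 0) := (hi1.sub hi2).const_mul (2 * a)
  rw [← ofReal_integral_eq_lintegral_ofReal hi]
  · apply ENNReal.ofReal_le_ofReal
    rw [integral_const_mul, integral_sub hi1 hi2, integral_exp_mul_Ioi (by linarith),
      integral_exp_mul_Ioi (by norm_num)]
    apply le_of_eq
    have h1 : -1 + a ≠ 0 := by linarith
    have h2 : 1 - a ≠ 0 := by linarith
    simp only [mul_zero, Real.exp_zero, neg_sub, sub_eq_neg_add a]
    field_simp
    ring
  · refine (ae_restrict_iff' measurableSet_Ioi).2 (Filter.Eventually.of_forall fun t ht => ?_)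
    have ht : (0 : ℝ) < t := ht
    have : Real.exp (-1 * t) ≤ Real.exp (-(1 - a) * t) := Real.exp_le_exp.2 (by nlinarith)
    simp only [Pi.zero_apply]
    exact mul_nonneg (by linarith) (by linarith)

lemma integrable_exp_taylor {Y : Ω → ℝ} (hYm : AEMeasurable Y μ) (hY0 : ∀ ω, 0 ≤ Y ω)
    (htail : ∀ t, 0 < t → μ.real {ω | t ≤ Y ω} ≤ 2 * Real.exp (-t))
    {a : ℝ} (ha0 : 0 ≤ a) (ha1 : a < 1) :
    Integrable (fun ω => Real.exp (a * Y ω) - 1 - a * Y ω) μ := by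
  refine ⟨by fun_prop, ?_⟩
  rw [hasFiniteIntegral_iff_ofReal (Filter.Eventually.of_forall fun ω => exp_taylor_nonneg _)]
  exact (lintegral_exp_taylor_le hYm hY0 htail ha0 ha1).trans_lt ENNReal.ofReal_lt_top

lemma integral_exp_taylor_le {Y : Ω → ℝ} (hYm : AEMeasurable Y μ) (hY0 : ∀ ω, 0 ≤ Y ω)
    (htail : ∀ t, 0 < t → μ.real {ω | t ≤ Y ω} ≤ 2 * Real.exp (-t))
    {a : ℝ} (ha0 : 0 ≤ a) (ha1 : a < 1) :
    ∫ ω, (Real.exp (a * Y ω) - 1 - a * Y ω) ∂μ ≤ 2 * a ^ 2 / (1 - a) := by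
  rw [integral_eq_lintegral_of_nonneg_ae (Filter.Eventually.of_forall fun ω =>
    exp_taylor_nonneg _) (integrable_exp_taylor hYm hY0 htail ha0 ha1).1]
  exact ENNReal.toReal_le_of_le_ofReal (div_nonneg (by positivity) (by linarith))
    (lintegral_exp_taylor_le hYm hY0 htail ha0 ha1)

lemma integrable_exp_mul_of_tail {Y : Ω → ℝ} (hYm : AEMeasurable Y μ) (hY0 : ∀ ω, 0 ≤ Y ω)
    (hYi : Integrable Y μ)
    (htail : ∀ t, 0 < t → μ.real {ω | t ≤ Y ω} ≤ 2 * Real.exp (-t))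
    {b : ℝ} (hb : |b| < 1) : Integrable (fun ω => Real.exp (b * Y ω)) μ := by
  have h := ((integrable_exp_taylor hYm hY0 htail (abs_nonneg b) hb).add
    (integrable_const (1 : ℝ))).add (hYi.const_mul |b|)
  refine h.mono' (by fun_prop) (Filter.Eventually.of_forall fun ω => ?_)
  simp only [Pi.add_apply, Real.norm_eq_abs, Real.abs_exp]
  have : Real.exp (b * Y ω) ≤ Real.exp (|b| * Y ω) :=
    Real.exp_le_exp.2 (mul_le_mul_of_nonneg_right (le_abs_self b) (hY0 ω))
  linarith

/-- A nonnegative variable with tail `2 exp (-t)` is sub-gamma after centering. -/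
lemma mgf_centered_le_of_tail {Y : Ω → ℝ} (hYm : AEMeasurable Y μ) (hY0 : ∀ ω, 0 ≤ Y ω)
    (hYi : Integrable Y μ)
    (htail : ∀ t, 0 < t → μ.real {ω | t ≤ Y ω} ≤ 2 * Real.exp (-t))
    {b : ℝ} (hb : |b| < 1) :
    mgf (fun ω => Y ω - ∫ ω, Y ω ∂μ) μ b ≤ Real.exp (2 * b ^ 2 / (1 - |b|)) := by
  have hexp := integrable_exp_mul_of_tail hYm hY0 hYi htail hb
  have hT := integrable_exp_taylor hYm hY0 htail (abs_nonneg b) hb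
  have hTle := integral_exp_taylor_le hYm hY0 htail (abs_nonneg b) hb
  rw [sq_abs] at hTle
  set m := ∫ ω, Y ω ∂μ
  set q := 2 * b ^ 2 / (1 - |b|)
  have h1b : Integrable (fun ω => 1 + b * Y ω) μ := (integrable_const _).add (hYi.const_mul b)
  have hpt : ∀ ω, Real.exp (b * Y ω) ≤
      1 + b * Y ω + (Real.exp (|b| * Y ω) - 1 - |b| * Y ω) := by
    intro ω
    rcases le_total 0 b with h | h
    · rw [abs_of_nonneg h]; linarith
    · rw [abs_of_nonpos h]
      have := exp_neg_taylor_le (x := -b * Y ω) (mul_nonneg (by linarith) (hY0 ω))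
      rw [show -(-b * Y ω) = b * Y ω by ring] at this
      linarith
  have hE : ∫ ω, Real.exp (b * Y ω) ∂μ ≤ Real.exp (b * m + q) := by
    calc ∫ ω, Real.exp (b * Y ω) ∂μ
        ≤ ∫ ω, (1 + b * Y ω + (Real.exp (|b| * Y ω) - 1 - |b| * Y ω)) ∂μ :=
          integral_mono hexp (h1b.add hT) hpt
      _ = 1 + b * m + ∫ ω, (Real.exp (|b| * Y ω) - 1 - |b| * Y ω) ∂μ := by
          rw [integral_add h1b hT,
            integral_add (integrable_const _) (hYi.const_mul b), integral_const_mul]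
          simp [m]
      _ ≤ b * m + q + 1 := by linarith
      _ ≤ Real.exp (b * m + q) := Real.add_one_le_exp _
  calc mgf (fun ω => Y ω - m) μ b = Real.exp (-(b * m)) * ∫ ω, Real.exp (b * Y ω) ∂μ := by
        rw [mgf, ← integral_const_mul]
        congr 1; ext ω
        rw [← Real.exp_add]; ring_nf
    _ ≤ Real.exp (-(b * m)) * Real.exp (b * m + q) := by gcongr
    _ = Real.exp q := by rw [← Real.exp_add]; ring_nf

end Tail

/-! ### Chernoff bounds for sums -/

section Bernstein

variable {Ω : Type*} [MeasurableSpace Ω] {P : Measure Ω} [IsProbabilityMeasure P]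

/-- Without integrability the `mgf` of the sum would take the default value `0`, but it is a product
of positive factors. -/
lemma integrable_exp_mul_sum_of_iIndepFun {N : ℕ} {Z : Fin N → Ω → ℝ} (hind : iIndepFun Z P)
    (hZm : ∀ i, AEMeasurable (Z i) P) {b : ℝ}
    (hint : ∀ i, Integrable (fun ω => Real.exp (b * Z i ω)) P) :
    Integrable (fun ω => Real.exp (b * (∑ i, Z i) ω)) P := by
  by_contra h
  have h0 : mgf (∑ i, Z i) P b = 0 := integral_undef h
  rw [hind.mgf_sum₀ hZm] at h0
  exact (Finset.prod_pos fun i _ => mgf_pos (hint i)).ne' h0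

lemma measure_sum_ge_le_of_mgf_le {N : ℕ} (hN : 0 < N) {Z : Fin N → Ω → ℝ} (hind : iIndepFun Z P)
    (hZm : ∀ i, AEMeasurable (Z i) P)
    (hint : ∀ i, ∀ b : ℝ, |b| < 1 → Integrable (fun ω => Real.exp (b * Z i ω)) P)
    (hmgf : ∀ i, ∀ b : ℝ, |b| < 1 → mgf (Z i) P b ≤ Real.exp (2 * b ^ 2 / (1 - |b|)))
    {t : ℝ} (ht : 0 ≤ t) :
    P.real {ω | N * (Real.sqrt (8 * t / N) + t / N) ≤ (∑ i, Z i) ω} ≤ Real.exp (-t) := by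
  have hNR : (0 : ℝ) < N := by exact_mod_cast hN
  set q := Real.sqrt 2
  have hq0 : 0 < q := by positivity
  have hq2 : q ^ 2 = 2 := Real.sq_sqrt (by norm_num)
  set r := Real.sqrt (t / N)
  have hr0 : 0 ≤ r := Real.sqrt_nonneg _
  have hr2 : r ^ 2 = t / N := Real.sq_sqrt (by positivity)
  have h8 : Real.sqrt (8 * t / N) = 2 * q * r := by
    rw [show 8 * t / N = (2 * q * r) ^ 2 by rw [mul_pow, mul_pow, hq2, hr2]; ring]
    exact Real.sqrt_sq (by positivity)
  -- The minimizer of the Chernoff exponent `2b²/(1-b) - b(2qr + r²)`; its minimum is exactly `-r² =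
  -- -t/N`.
  set b := r / (q + r)
  have hb0 : 0 ≤ b := by positivity
  have hb1 : b < 1 := (div_lt_one (by positivity)).2 (by linarith)
  have hbabs : |b| = b := abs_of_nonneg hb0
  have hint' := integrable_exp_mul_sum_of_iIndepFun hind hZm
    (fun i => hint i b (by rwa [hbabs]))
  refine (measure_ge_le_exp_mul_mgf _ hb0 hint').trans ?_
  rw [hind.mgf_sum₀ hZm]
  calc Real.exp (-b * (N * (Real.sqrt (8 * t / N) + t / N))) * ∏ i, mgf (Z i) P b
      ≤ Real.exp (-b * (N * (Real.sqrt (8 * t / N) + t / N))) *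
          ∏ _i : Fin N, Real.exp (2 * b ^ 2 / (1 - |b|)) := by
        gcongr with i
        · exact fun i _ => mgf_nonneg
        · exact hmgf i b (by rwa [hbabs])
    _ = Real.exp (-t) := by
        rw [Finset.prod_const, ← Real.exp_nat_mul, ← Real.exp_add, hbabs, h8, ← hr2,
          show t = N * r ^ 2 by rw [hr2]; field_simp]
        congr 1
        have h1 : 1 - b = q / (q + r) := by simp only [b]; field_simp; ring
        have hqr : q + r ≠ 0 := by positivity
        rw [h1]
        simp only [b, Finset.card_univ, Fintype.card_fin]
        field_simp
        linear_combination (-r ^ 2) * hq2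

/-- **Bernstein's inequality** for centered sub-gamma variables. -/
lemma measure_abs_sum_ge_le_of_mgf_le {N : ℕ} (hN : 0 < N) {Z : Fin N → Ω → ℝ}
    (hind : iIndepFun Z P) (hZm : ∀ i, AEMeasurable (Z i) P)
    (hint : ∀ i, ∀ b : ℝ, |b| < 1 → Integrable (fun ω => Real.exp (b * Z i ω)) P)
    (hmgf : ∀ i, ∀ b : ℝ, |b| < 1 → mgf (Z i) P b ≤ Real.exp (2 * b ^ 2 / (1 - |b|)))
    {t : ℝ} (ht : 0 ≤ t) :
    P.real {ω | N * (Real.sqrt (8 * t / N) + t / N) ≤ |∑ i, Z i ω|} ≤ 2 * Real.exp (-t) := by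
  have h1 := measure_sum_ge_le_of_mgf_le hN hind hZm hint hmgf ht
  have h2 := measure_sum_ge_le_of_mgf_le hN (Z := fun i ω => -Z i ω)
    (hind.comp (fun _ x => -x) (fun _ => measurable_neg)) (fun i => (hZm i).neg)
    (fun i b hb => by simpa using hint i (-b) (by simpa using hb))
    (fun i b hb => by
      have := hmgf i (-b) (by simpa using hb)
      rw [← mgf_neg, neg_sq, abs_neg] at this
      exact this) ht
  have hsub : {ω | N * (Real.sqrt (8 * t / N) + t / N) ≤ |∑ i, Z i ω|} ⊆
      {ω | N * (Real.sqrt (8 * t / N) + t / N) ≤ (∑ i, Z i) ω} ∪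
      {ω | N * (Real.sqrt (8 * t / N) + t / N) ≤ (∑ i, fun ω => -Z i ω) ω} := by
    intro ω hω
    simp only [Set.mem_ofPred_eq, Set.mem_union, Finset.sum_apply, Finset.sum_neg_distrib] at hω ⊢
    exact le_abs.1 hω
  calc _ ≤ _ := measureReal_mono hsub
    _ ≤ _ := measureReal_union_le _ _
    _ ≤ _ := by linarith

end Bernstein

/-! ### Squares of sub-Gaussian variables -/

section Square

variable {Ω : Type*} [MeasurableSpace Ω] {P : Measure Ω} [IsProbabilityMeasure P]

lemma measure_sq_div_ge_le {X : Ω → ℝ} {s : ℝ≥0} (hs : 0 < s) (hX : HasSubgaussianMGF X s P)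
    {t : ℝ} (ht : 0 < t) :
    P.real {ω | t ≤ X ω ^ 2 / (2 * s)} ≤ 2 * Real.exp (-t) := by
  have hs' : (0 : ℝ) < s := hs
  have hε : 0 ≤ Real.sqrt (2 * s * t) := Real.sqrt_nonneg _
  have he : -Real.sqrt (2 * s * t) ^ 2 / (2 * s) = -t := by
    rw [Real.sq_sqrt (by positivity)]; field_simp
  have h1 := hX.measure_ge_le hε
  have h2 := hX.neg.measure_ge_le hε
  rw [he] at h1 h2
  have hsub : {ω | t ≤ X ω ^ 2 / (2 * s)} ⊆
      {ω | Real.sqrt (2 * s * t) ≤ X ω} ∪ {ω | Real.sqrt (2 * s * t) ≤ (-X) ω} := by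
    intro ω hω
    simp only [Set.mem_ofPred_eq, Set.mem_union, Pi.neg_apply] at hω ⊢
    apply le_abs.1
    apply Real.sqrt_le_iff.2 ⟨abs_nonneg _, _⟩
    rw [sq_abs]
    rw [le_div_iff₀ (by positivity)] at hω
    linarith
  calc _ ≤ _ := measureReal_mono hsub
    _ ≤ _ := measureReal_union_le _ _
    _ ≤ _ := by linarith

/-- Deviation of the empirical second moment of independent sub-Gaussian variables. -/
lemma measure_sq_deviation_le {N : ℕ} (hN : 0 < N) {X : Fin N → Ω → ℝ} {s : ℝ≥0}
    (hind : iIndepFun X P) (hX : ∀ i, HasSubgaussianMGF (X i) s P)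
    {m : ℝ} (hm : ∀ i, ∫ ω, X i ω ^ 2 ∂P = m) {t : ℝ} (ht : 0 ≤ t) :
    P.real {ω | s * (Real.sqrt (32 * t / N) + 2 * t / N) < |m - (N : ℝ)⁻¹ * ∑ i, X i ω ^ 2|}
      ≤ 2 * Real.exp (-t) := by
  have hNR : (0 : ℝ) < N := by exact_mod_cast hN
  -- For `s = 0` the normalization by `2s` is meaningless, but then every `X i` vanishes almost
  -- surely.
  rcases eq_or_ne s 0 with rfl | hs
  · have h0 : ∀ i, X i =ᵐ[P] 0 := fun i => (hX i).ae_eq_zero_of_hasSubgaussianMGF_zero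
    have hm0 : m = 0 := by
      rw [← hm ⟨0, hN⟩, ← integral_zero Ω ℝ]
      apply integral_congr_ae
      filter_upwards [h0 ⟨0, hN⟩] with ω hω
      simp [hω]
    have : P {ω | ((0 : ℝ≥0) : ℝ) * (Real.sqrt (32 * t / N) + 2 * t / N) <
        |m - (N : ℝ)⁻¹ * ∑ i, X i ω ^ 2|} = 0 := by
      rw [measure_eq_zero_iff_ae_notMem]
      filter_upwards [ae_all_iff.2 h0] with ω hω
      simp [hm0, hω]
    rw [measureReal_def, this]
    simp; positivity
  · have hs' : (0 : ℝ) < s := by exact_mod_cast pos_iff_ne_zero.2 hs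
    have hsp : 0 < s := pos_iff_ne_zero.2 hs
    let Y : Fin N → Ω → ℝ := fun i ω => X i ω ^ 2 / (2 * s)
    have hYm : ∀ i, AEMeasurable (Y i) P := fun i => ((hX i).aemeasurable.pow_const 2).div_const _
    have hY0 : ∀ i ω, 0 ≤ Y i ω := fun i ω => by positivity
    have hYi : ∀ i, Integrable (Y i) P := fun i => ((hX i).memLp 2).integrable_sq.div_const _
    have hEY : ∀ i, ∫ ω, Y i ω ∂P = m / (2 * s) := fun i => by
      simp only [Y, integral_div, hm]
    have htail : ∀ i t, 0 < t → P.real {ω | t ≤ Y i ω} ≤ 2 * Real.exp (-t) :=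
      fun i t ht => measure_sq_div_ge_le hsp (hX i) ht
    have key := measure_abs_sum_ge_le_of_mgf_le hN (Z := fun i ω => Y i ω - m / (2 * s))
      (hind.comp (fun _ x => x ^ 2 / (2 * s) - m / (2 * s)) (fun _ => by fun_prop))
      (fun i => (hYm i).sub_const _)
      (fun i b hb => by
        have := (integrable_exp_mul_of_tail (hYm i) (hY0 i) (hYi i) (htail i) hb).const_mul
          (Real.exp (-(b * (m / (2 * s)))))
        refine this.congr (Filter.Eventually.of_forall fun ω => ?_)
        simp only [← Real.exp_add]; ring_nf)
      (fun i b hb => by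
        have := mgf_centered_le_of_tail (hYm i) (hY0 i) (hYi i) (htail i) hb
        rwa [hEY] at this) ht
    refine (measureReal_mono ?_).trans key
    intro ω hω
    simp only [Set.mem_ofPred_eq] at hω ⊢
    have h32 : Real.sqrt (32 * t / N) = 2 * Real.sqrt (8 * t / N) := by
      rw [show 32 * t / N = 2 ^ 2 * (8 * t / N) by ring, Real.sqrt_mul (by norm_num),
        Real.sqrt_sq (by norm_num)]
    have hsum : ∑ i, (Y i ω - m / (2 * s)) =
        -(N / (2 * s) * (m - (N : ℝ)⁻¹ * ∑ i, X i ω ^ 2)) := by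
      simp only [Y, Finset.sum_sub_distrib, ← Finset.sum_div, Finset.sum_const, Finset.card_univ,
        Fintype.card_fin, nsmul_eq_mul]
      field_simp; ring
    rw [hsum, abs_neg, abs_mul, abs_of_pos (by positivity : (0 : ℝ) < N / (2 * s))]
    calc N * (Real.sqrt (8 * t / N) + t / N)
        = N / (2 * s) * (s * (Real.sqrt (32 * t / N) + 2 * t / N)) := by
          rw [h32]; field_simp
      _ ≤ _ := by gcongr

end Square

end SubGaussianCovariance

namespace SubGaussianCovariance

/-! ### Nets of the unit sphere -/

section Net

open Metric Module

/-- Volume bound on the size of an `ε`-separated subset of the unit ball. -/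
lemma card_le_of_separated {E : Type*} [NormedAddCommGroup E] [NormedSpace ℝ E]
    [FiniteDimensional ℝ E] {ε : ℝ} (hε : 0 < ε) (s : Finset E) (hs : ∀ c ∈ s, ‖c‖ ≤ 1)
    (h : ∀ c ∈ s, ∀ d ∈ s, c ≠ d → ε ≤ ‖c - d‖) :
    (s.card : ℝ) ≤ (1 + 2 / ε) ^ finrank ℝ E := by
  borelize E
  let μ : Measure E := Measure.addHaar
  have hδ : 0 < ε / 2 := by positivity
  have hρ : 0 < 1 + ε / 2 := by positivity
  have D : Set.Pairwise (s : Set E) (Function.onFun Disjoint fun c => ball (c : E) (ε / 2)) := by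
    rintro c hc d hd hcd
    apply ball_disjoint_ball
    rw [dist_eq_norm]
    linarith [h c hc d hd hcd]
  have hsub : (⋃ c ∈ s, ball (c : E) (ε / 2)) ⊆ ball (0 : E) (1 + ε / 2) := by
    refine Set.iUnion₂_subset fun x hx => ?_
    apply ball_subset_ball'
    rw [dist_zero_right]
    linarith [hs x hx]
  have I : (s.card : ENNReal) * ENNReal.ofReal ((ε / 2) ^ finrank ℝ E) * μ (ball 0 1) ≤
      ENNReal.ofReal ((1 + ε / 2) ^ finrank ℝ E) * μ (ball 0 1) :=
    calc
      _ = μ (⋃ c ∈ s, ball (c : E) (ε / 2)) := by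
        rw [measure_biUnion_finset D fun c _ => measurableSet_ball]
        simp only [μ.addHaar_ball_of_pos _ hδ, Finset.sum_const, nsmul_eq_mul, mul_assoc]
      _ ≤ μ (ball (0 : E) (1 + ε / 2)) := measure_mono hsub
      _ = _ := by simp only [μ.addHaar_ball_of_pos _ hρ]
  have J : (s.card : ENNReal) * ENNReal.ofReal ((ε / 2) ^ finrank ℝ E) ≤
      ENNReal.ofReal ((1 + ε / 2) ^ finrank ℝ E) :=
    (ENNReal.mul_le_mul_iff_left (measure_ball_pos _ _ zero_lt_one).ne' measure_ball_lt_top.ne).1 I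
  have K := ENNReal.toReal_le_of_le_ofReal (pow_nonneg hρ.le _) J
  rw [ENNReal.toReal_mul, ENNReal.toReal_natCast,
    ENNReal.toReal_ofReal (pow_nonneg hδ.le _), ← le_div_iff₀ (pow_pos hδ _), ← div_pow] at K
  convert! K using 2
  field_simp
  ring

/-- The unit sphere has an `ε`-net with at most `(1 + 2 / ε) ^ dim` points. -/
lemma exists_sphere_net {E : Type*} [NormedAddCommGroup E] [NormedSpace ℝ E]
    [FiniteDimensional ℝ E] {ε : ℝ} (hε : 0 < ε) :
    ∃ s : Finset E, (∀ u ∈ s, ‖u‖ = 1) ∧ (s.card : ℝ) ≤ (1 + 2 / ε) ^ finrank ℝ E ∧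
      ∀ x : E, ‖x‖ = 1 → ∃ u ∈ s, ‖x - u‖ ≤ ε := by
  classical
  -- An `ε`-separated set of largest cardinality is an `ε`-net, since an uncovered point could be
  -- added to it. The volume bound makes the maximum exist.
  let p : ℕ → Prop := fun k => ∃ s : Finset E, (∀ u ∈ s, ‖u‖ = 1) ∧
    (∀ c ∈ s, ∀ d ∈ s, c ≠ d → ε ≤ ‖c - d‖) ∧ s.card = k
  have hbd : ∀ k, p k → k ≤ ⌊(1 + 2 / ε) ^ finrank ℝ E⌋₊ := by
    rintro k ⟨s, h1, h2, rfl⟩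
    exact Nat.le_floor (card_le_of_separated hε s (fun c hc => (h1 c hc).le) h2)
  have hp0 : p 0 := ⟨∅, by simp, by simp, by simp⟩
  obtain ⟨s, h1, h2, hcard⟩ := Nat.findGreatest_spec (P := p) (Nat.zero_le _) hp0
  refine ⟨s, h1, card_le_of_separated hε s (fun c hc => (h1 c hc).le) h2, fun x hx => ?_⟩
  by_contra! hcon
  have hxs : x ∉ s := fun hxs => by
    have := hcon x hxs
    simp at this
    linarith
  have hp : p (s.card + 1) := by
    refine ⟨insert x s, ?_, ?_, Finset.card_insert_of_notMem hxs⟩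
    · intro u hu
      rcases Finset.mem_insert.1 hu with rfl | hu
      · exact hx
      · exact h1 u hu
    · intro c hc d hd hcd
      rcases Finset.mem_insert.1 hc with hcx | hcs <;> rcases Finset.mem_insert.1 hd with hdx | hds
      · exact absurd (hcx.trans hdx.symm) hcd
      · rw [hcx]; exact (hcon d hds).le
      · rw [hdx, norm_sub_rev]; exact (hcon c hcs).le
      · exact h2 c hcs d hds hcd
  have := (Nat.le_findGreatest (hbd _ hp) hp).trans_eq hcard.symm
  exact absurd this (by simp)

lemma norm_toLp_sq {n : ℕ} (v : Fin n → ℝ) : ‖WithLp.toLp 2 v‖ ^ 2 = v ⬝ᵥ v := by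
  rw [EuclideanSpace.norm_sq_eq]
  simp [dotProduct, sq]

/-- The Euclidean `ε`-net of the unit sphere in coordinates. -/
lemma exists_dotProduct_net (n : ℕ) {ε : ℝ} (hε : 0 < ε) :
    ∃ s : Finset (Fin n → ℝ), (∀ u ∈ s, u ⬝ᵥ u = 1) ∧ (s.card : ℝ) ≤ (1 + 2 / ε) ^ n ∧
      ∀ x : Fin n → ℝ, x ⬝ᵥ x = 1 → ∃ u ∈ s, (x - u) ⬝ᵥ (x - u) ≤ ε ^ 2 := by
  classical
  obtain ⟨s, h1, h2, h3⟩ := exists_sphere_net (E := EuclideanSpace ℝ (Fin n)) hε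
  rw [finrank_euclideanSpace_fin] at h2
  refine ⟨s.image WithLp.ofLp, ?_, ?_, ?_⟩
  · intro u hu
    obtain ⟨v, hv, rfl⟩ := Finset.mem_image.1 hu
    rw [← norm_toLp_sq, WithLp.toLp_ofLp, h1 v hv, one_pow]
  · exact le_trans (by exact_mod_cast Finset.card_image_le) h2
  · intro x hx
    rw [← norm_toLp_sq, pow_eq_one_iff_of_nonneg (norm_nonneg _) two_ne_zero] at hx
    obtain ⟨u, hu, hxu⟩ := h3 _ hx
    refine ⟨WithLp.ofLp u, Finset.mem_image_of_mem _ hu, ?_⟩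
    rw [← norm_toLp_sq]
    gcongr
    simpa using hxu

end Net

/-! ### Quadratic forms controlled on a net -/

section Quadratic

variable {n : ℕ}

lemma dotProduct_mulVec_comm_of_symm {D : Matrix (Fin n) (Fin n) ℝ} (hD : D.transpose = D)
    (x y : Fin n → ℝ) : x ⬝ᵥ D.mulVec y = y ⬝ᵥ D.mulVec x := by
  rw [Matrix.dotProduct_mulVec, ← Matrix.mulVec_transpose, hD, dotProduct_comm]

lemma abs_quadratic_le_of_sphere {D : Matrix (Fin n) (Fin n) ℝ} {M : ℝ}
    (h : ∀ x : Fin n → ℝ, x ⬝ᵥ x = 1 → |x ⬝ᵥ D.mulVec x| ≤ M) (y : Fin n → ℝ) :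
    |y ⬝ᵥ D.mulVec y| ≤ M * (y ⬝ᵥ y) := by
  have hyy : 0 ≤ y ⬝ᵥ y := by rw [← norm_toLp_sq]; positivity
  rcases hyy.eq_or_lt with h0 | hpos
  · have : y = 0 := dotProduct_self_eq_zero.1 h0.symm
    simp [this]
  · set r := Real.sqrt (y ⬝ᵥ y)
    have hr : 0 < r := Real.sqrt_pos.2 hpos
    have hr2 : r * r = y ⬝ᵥ y := Real.mul_self_sqrt hyy
    have h1 := h (r⁻¹ • y) (by simp [smul_dotProduct, dotProduct_smul, ← hr2]; field_simp)
    simp only [Matrix.mulVec_smul, smul_dotProduct, dotProduct_smul, smul_eq_mul, abs_mul,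
      abs_inv, abs_of_pos hr] at h1
    rw [← hr2]
    calc |y ⬝ᵥ D.mulVec y| = r⁻¹ * (r⁻¹ * |y ⬝ᵥ D.mulVec y|) * (r * r) := by field_simp
      _ ≤ M * (r * r) := by gcongr

lemma bilinear_sub_add {D : Matrix (Fin n) (Fin n) ℝ} (hD : D.transpose = D) (x u : Fin n → ℝ) :
    x ⬝ᵥ D.mulVec x - u ⬝ᵥ D.mulVec u = (x - u) ⬝ᵥ D.mulVec (x + u) := by
  simp only [Matrix.mulVec_add, sub_dotProduct, dotProduct_add]
  rw [dotProduct_mulVec_comm_of_symm hD u x]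
  ring

/-- Polarization and the parallelogram law. After rescaling `p` and `q`, this replaces an operator
norm estimate. -/
lemma abs_bilinear_le {D : Matrix (Fin n) (Fin n) ℝ} (hD : D.transpose = D) {M : ℝ}
    (h : ∀ y : Fin n → ℝ, |y ⬝ᵥ D.mulVec y| ≤ M * (y ⬝ᵥ y)) (p q : Fin n → ℝ) :
    |p ⬝ᵥ D.mulVec q| ≤ M * (p ⬝ᵥ p + q ⬝ᵥ q) / 2 := by
  have h1 := abs_le.1 (h (p + q))
  have h2 := abs_le.1 (h (p - q))
  have hc := dotProduct_mulVec_comm_of_symm hD q p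
  have hc' := dotProduct_comm q p
  simp only [Matrix.mulVec_add, Matrix.mulVec_sub, add_dotProduct, sub_dotProduct, dotProduct_add,
    dotProduct_sub, hc, hc'] at h1 h2
  rw [abs_le]
  constructor <;> nlinarith [h1.1, h1.2, h2.1, h2.2]

lemma isCompact_dotProduct_sphere (n : ℕ) : IsCompact {x : Fin n → ℝ | x ⬝ᵥ x = 1} := by
  have hcl : IsClosed {x : Fin n → ℝ | x ⬝ᵥ x = 1} :=
    isClosed_eq (by unfold dotProduct; fun_prop) continuous_const
  refine (isCompact_univ_pi fun _ : Fin n => isCompact_Icc (a := (-1 : ℝ)) (b := 1)).of_isClosed_subset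
    hcl ?_
  intro x hx i _
  have : x i ^ 2 ≤ 1 := by
    rw [← (show x ⬝ᵥ x = 1 from hx), sq]
    exact Finset.single_le_sum (f := fun i => x i * x i) (fun i _ => mul_self_nonneg _)
      (Finset.mem_univ i)
  exact abs_le.1 (abs_le_one_iff_mul_self_le_one.2 (by nlinarith))

/-- Control of a quadratic form on an `ε`-net gives control everywhere. -/
lemma abs_quadratic_le_of_net {D : Matrix (Fin n) (Fin n) ℝ} (hD : D.transpose = D) {ε : ℝ}
    (hε : 0 < ε) (hε' : ε < 1 / 2) {s : Finset (Fin n → ℝ)} (hs : ∀ u ∈ s, u ⬝ᵥ u = 1)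
    (hnet : ∀ x : Fin n → ℝ, x ⬝ᵥ x = 1 → ∃ u ∈ s, (x - u) ⬝ᵥ (x - u) ≤ ε ^ 2)
    {m : ℝ} (hm : ∀ u ∈ s, |u ⬝ᵥ D.mulVec u| ≤ m) (y : Fin n → ℝ) :
    |y ⬝ᵥ D.mulVec y| ≤ m / (1 - 2 * ε) * (y ⬝ᵥ y) := by
  refine abs_quadratic_le_of_sphere (fun x hx => ?_) y
  -- At a maximizer `z` with value `M` and a net point `u` near it, `M ≤ m + 2εM`, which is solved
  -- for `M`.
  obtain ⟨z, hz, hmax⟩ := (isCompact_dotProduct_sphere n).exists_isMaxOn ⟨x, hx⟩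
    (f := fun x : Fin n → ℝ => |x ⬝ᵥ D.mulVec x|)
    (by unfold Matrix.mulVec dotProduct; fun_prop)
  refine (hmax hx).trans ?_
  have hz : z ⬝ᵥ z = 1 := hz
  set M := |z ⬝ᵥ D.mulVec z|
  have hM0 : 0 ≤ M := abs_nonneg _
  have hMall : ∀ y : Fin n → ℝ, |y ⬝ᵥ D.mulVec y| ≤ M * (y ⬝ᵥ y) :=
    abs_quadratic_le_of_sphere fun x hx => hmax hx
  obtain ⟨u, hu, hzu⟩ := hnet z hz
  -- `‖z - u‖ ≤ ε` and `‖z + u‖ ≤ 2`, so both rescaled vectors have norm at most one.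
  have hb := abs_bilinear_le hD hMall (ε⁻¹ • (z - u)) ((2 : ℝ)⁻¹ • (z + u))
  have hsum : (z + u) ⬝ᵥ (z + u) ≤ 4 := by
    have h0 : 0 ≤ (z - u) ⬝ᵥ (z - u) := by rw [← norm_toLp_sq]; positivity
    have h1 := hs u hu
    have hc := dotProduct_comm u z
    simp only [add_dotProduct, sub_dotProduct, dotProduct_add, dotProduct_sub, hz, h1, hc] at h0 ⊢
    linarith
  simp only [Matrix.mulVec_smul, smul_dotProduct, dotProduct_smul, smul_eq_mul,
    ← bilinear_sub_add hD, abs_mul, abs_inv, abs_of_pos hε, abs_two] at hb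
  have h2 : |z ⬝ᵥ D.mulVec z - u ⬝ᵥ D.mulVec u| ≤ 2 * ε * M := by
    have h3 : ε⁻¹ * (ε⁻¹ * ((z - u) ⬝ᵥ (z - u))) + 2⁻¹ * (2⁻¹ * ((z + u) ⬝ᵥ (z + u))) ≤ 2 := by
      have : ε⁻¹ * (ε⁻¹ * ((z - u) ⬝ᵥ (z - u))) ≤ ε⁻¹ * (ε⁻¹ * ε ^ 2) := by gcongr
      have h4 : ε⁻¹ * (ε⁻¹ * ε ^ 2) = 1 := by field_simp
      linarith
    have h5 : ∀ A : ℝ, 2⁻¹ * (ε⁻¹ * A) ≤ M → A ≤ 2 * ε * M := by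
      intro A hA
      calc A = 2 * ε * (2⁻¹ * (ε⁻¹ * A)) := by field_simp
        _ ≤ _ := by gcongr
    apply h5
    refine hb.trans ?_
    nlinarith
  have h6 := abs_sub_abs_le_abs_sub (z ⬝ᵥ D.mulVec z) (u ⬝ᵥ D.mulVec u)
  rw [le_div_iff₀ (by linarith)]
  have := hm u hu
  change M - _ ≤ _ at h6
  linarith

end Quadratic

end SubGaussianCovariance

namespace SubGaussianCovariance

/-! ### Second moments -/

section Moments

variable {Ω : Type*} [MeasurableSpace Ω] {μ : Measure Ω} {n : ℕ} {w : Ω → Fin n → ℝ}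

lemma integral_dotProduct_mul_dotProduct (hw2 : ∀ i, MemLp (fun ω => w ω i) 2 μ)
    (a b : Fin n → ℝ) :
    ∫ ω, (a ⬝ᵥ w ω) * (b ⬝ᵥ w ω) ∂μ = a ⬝ᵥ (secondMoment w μ).mulVec b := by
  have hint : ∀ i j, Integrable (fun ω => a i * w ω i * (b j * w ω j)) μ := fun i j =>
    ((hw2 i).const_mul (a i)).integrable_mul ((hw2 j).const_mul (b j))
  simp only [dotProduct, Matrix.mulVec, secondMoment, Matrix.of_apply, Finset.sum_mul_sum]
  rw [integral_finsetSum _ fun i _ => integrable_finsetSum _ fun j _ => hint i j]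
  refine Finset.sum_congr rfl fun i _ => ?_
  rw [integral_finsetSum _ fun j _ => hint i j, Finset.mul_sum]
  refine Finset.sum_congr rfl fun j _ => ?_
  rw [← mul_assoc, mul_right_comm, ← integral_const_mul]
  congr 1; ext ω; ring

lemma integral_dotProduct_sq (hw2 : ∀ i, MemLp (fun ω => w ω i) 2 μ) (a : Fin n → ℝ) :
    ∫ ω, (a ⬝ᵥ w ω) ^ 2 ∂μ = a ⬝ᵥ (secondMoment w μ).mulVec a := by
  simp only [sq, integral_dotProduct_mul_dotProduct hw2]

lemma secondMoment_posSemidef (hw2 : ∀ i, MemLp (fun ω => w ω i) 2 μ) :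
    (secondMoment w μ).PosSemidef := by
  refine Matrix.PosSemidef.of_dotProduct_mulVec_nonneg ?_ fun x => ?_
  · ext i j
    simp [secondMoment, mul_comm]
  · rw [star_trivial, ← integral_dotProduct_sq hw2]
    exact integral_nonneg fun ω => sq_nonneg _

lemma ae_dotProduct_eq_zero (hw2 : ∀ i, MemLp (fun ω => w ω i) 2 μ) {a : Fin n → ℝ}
    (ha : (secondMoment w μ).mulVec a = 0) : ∀ᵐ ω ∂μ, a ⬝ᵥ w ω = 0 := by
  have h := integral_dotProduct_sq hw2 a
  rw [ha, dotProduct_zero] at h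
  have hL : MemLp (fun ω => a ⬝ᵥ w ω) 2 μ :=
    memLp_finsetSum _ fun i _ => (hw2 i).const_mul (a i)
  have h0 := (integral_eq_zero_iff_of_nonneg (fun ω => sq_nonneg _) hL.integrable_sq).1 h
  filter_upwards [h0] with ω hω
  simpa using hω

end Moments

/-! ### Square roots and pseudo-inverse square roots -/

section SquareRoots

variable {n : ℕ} {S : Matrix (Fin n) (Fin n) ℝ}

/-- The spectrum is finite, so the functional calculus accepts even `(√x)⁻¹`, discontinuous at `0`.
-/
lemma continuousOn_spectrum (S : Matrix (Fin n) (Fin n) ℝ) (f : ℝ → ℝ) :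
    ContinuousOn f (spectrum ℝ S) :=
  (Matrix.finite_real_spectrum (A := S)).continuousOn f

lemma cfc_transpose (f : ℝ → ℝ) : (cfc f S).transpose = cfc f S := by
  have h : IsSelfAdjoint (cfc f S) := cfc_predicate f S
  have h2 : (cfc f S).conjTranspose = cfc f S := h
  rwa [Matrix.conjTranspose_eq_transpose_of_trivial] at h2

lemma transpose_eq_of_posSemidef (hS : S.PosSemidef) : S.transpose = S := by
  have h : S.conjTranspose = S := hS.isHermitian
  rwa [Matrix.conjTranspose_eq_transpose_of_trivial] at h

lemma sqrt_mul_sqrt_cfc (hS : S.PosSemidef) : cfc Real.sqrt S * cfc Real.sqrt S = S := by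
  have hsa : IsSelfAdjoint S := hS.isHermitian
  rw [← cfc_mul _ _ S (continuousOn_spectrum S _) (continuousOn_spectrum S _)]
  conv_rhs => rw [← cfc_id ℝ S]
  refine cfc_congr fun x hx => ?_
  exact Real.mul_self_sqrt (spectrum_nonneg_of_nonneg hS.nonneg hx)

lemma mul_sqrt_mul_invSqrt (hS : S.PosSemidef) : S * (cfc Real.sqrt S * invSqrt S) = S := by
  have hsa : IsSelfAdjoint S := hS.isHermitian
  unfold invSqrt
  rw [← cfc_mul _ _ S (continuousOn_spectrum S _) (continuousOn_spectrum S _)]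
  nth_rw 1 [← cfc_id ℝ S]
  rw [← cfc_mul _ _ S (continuousOn_spectrum S _) (continuousOn_spectrum S _)]
  conv_rhs => rw [← cfc_id ℝ S]
  refine cfc_congr fun x hx => ?_
  rcases (spectrum_nonneg_of_nonneg hS.nonneg hx).eq_or_lt with h | h
  · simp [← h]
  · have : Real.sqrt x ≠ 0 := (Real.sqrt_pos.2 h).ne'
    simp [this]

lemma sqrt_mul_invSqrt_comm (S : Matrix (Fin n) (Fin n) ℝ) :
    cfc Real.sqrt S * invSqrt S = invSqrt S * cfc Real.sqrt S :=
  (cfc_commute_cfc _ _ S).eq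

/-- The whitened second moment, transported back by the square root. -/
lemma sqrt_conj_invSqrt_conj (hS : S.PosSemidef) :
    cfc Real.sqrt S * (invSqrt S * S * invSqrt S) * cfc Real.sqrt S = S := by
  have h1 := mul_sqrt_mul_invSqrt hS
  have h2 : cfc Real.sqrt S * invSqrt S * S = S := by
    have := congrArg Matrix.transpose h1
    rw [Matrix.transpose_mul, Matrix.transpose_mul, cfc_transpose, invSqrt, cfc_transpose,
      transpose_eq_of_posSemidef hS] at this
    rw [sqrt_mul_invSqrt_comm]
    exact this
  calc _ = cfc Real.sqrt S * invSqrt S * S * (invSqrt S * cfc Real.sqrt S) := by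
        simp only [Matrix.mul_assoc]
    _ = S := by rw [h2, ← sqrt_mul_invSqrt_comm, h1]

end SquareRoots

/-! ### The sample size threshold -/

section Constants

lemma c₂_pos {β ε : ℝ} (hβ : β ∈ Set.Ioo (0 : ℝ) 1) (hε : 0 < ε) (n : ℕ) : 0 < c₂ β ε n := by
  have h1 : 0 ≤ Real.log (1 + 2 / ε) := Real.log_nonneg (by
    have : 0 < 2 / ε := by positivity
    linarith)
  have h2 : 0 < Real.log (2 / β) := Real.log_pos (by
    rw [lt_div_iff₀ hβ.1]; linarith [hβ.2])
  unfold c₂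
  positivity

/-- Beyond the threshold `sampleBound`, the deviation is less than one. -/
lemma deviation_lt_one_of_sampleBound_lt {a b N : ℝ} (ha : 0 ≤ a) (hb : 0 < b) (hN : 0 < N)
    (h : sampleBound a b < N) : a * (Real.sqrt (32 * b / N) + 2 * b / N) < 1 := by
  rcases ha.eq_or_lt with rfl | ha
  · simp
  set q := Real.sqrt (4 * a ^ 2 + a)
  have hq2 : q ^ 2 = 4 * a ^ 2 + a := Real.sq_sqrt (by positivity)
  have hq0 : 0 < q := Real.sqrt_pos.2 (by positivity)
  -- In terms of `t` the claim is `a(t² + 4t) < 1`, that is, `t` lies below the positive root `(q -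
  -- 2a)/a = 1/(q + 2a)`. Squaring `t(q + 2a) < 1` yields exactly `sampleBound a b < N`.
  set t := Real.sqrt (2 * b / N)
  have ht2 : t ^ 2 = 2 * b / N := Real.sq_sqrt (by positivity)
  have ht0 : 0 < t := Real.sqrt_pos.2 (by positivity)
  have h32 : Real.sqrt (32 * b / N) = 4 * t := by
    rw [show 32 * b / N = 4 ^ 2 * (2 * b / N) by ring, Real.sqrt_mul (by norm_num),
      Real.sqrt_sq (by norm_num)]
  have hlt : (t * (q + 2 * a)) ^ 2 < 1 ^ 2 := by
    have : (q + 2 * a) ^ 2 * (2 * b) = sampleBound a b := by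
      unfold sampleBound
      change _ = 2 * a * b * (8 * a + 4 * q + 1)
      linear_combination 2 * b * hq2
    rw [mul_pow, ht2, div_mul_eq_mul_div, mul_comm, this, one_pow]
    exact (div_lt_one hN).2 h
  have hlt' : t * (q + 2 * a) < 1 := lt_of_pow_lt_pow_left₀ 2 zero_le_one hlt
  rw [h32, ← ht2]
  have hfac : (q + 2 * a) * (q - 2 * a) = a := by linear_combination hq2
  have hpos : 0 < q - 2 * a := by
    by_contra hcon
    nlinarith [mul_nonneg (by positivity : 0 ≤ q + 2 * a) (sub_nonneg.2 (not_lt.1 hcon))]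
  have h1 : a * t < q - 2 * a := by
    calc a * t = t * (q + 2 * a) * (q - 2 * a) := by rw [mul_assoc, hfac]; ring
      _ < 1 * (q - 2 * a) := by gcongr
      _ = _ := one_mul _
  have h2 : (a * t + 2 * a) ^ 2 < q ^ 2 := by gcongr; linarith
  nlinarith

end Constants

/-! ### Whitening and the Loewner bound -/

section Whitening

variable {Ω₀ Ω : Type*} [MeasurableSpace Ω₀] [MeasurableSpace Ω] {P₀ : Measure Ω₀} {P : Measure Ω}
  {n N : ℕ}

lemma hasSubgaussianMGF_of_identDistrib {X : Ω₀ → ℝ} {Y : Ω → ℝ} {s : ℝ≥0}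
    (h : IdentDistrib Y X P P₀) (hX : HasSubgaussianMGF X s P₀) : HasSubgaussianMGF Y s P where
  integrable_exp_mul t :=
    ((h.comp (u := fun y => Real.exp (t * y)) (by fun_prop)).integrable_iff).2
      (hX.integrable_exp_mul t)
  mgf_le t := by
    rw [mgf_congr_of_identDistrib Y X h t]
    exact hX.mgf_le t

lemma dotProduct_vecMulVec_mulVec (a v : Fin n → ℝ) :
    v ⬝ᵥ (Matrix.vecMulVec a a).mulVec v = (v ⬝ᵥ a) ^ 2 := by
  rw [Matrix.vecMulVec_mulVec, sq]
  simp [dotProduct_comm a v]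

lemma dotProduct_empiricalCov_mulVec (x : Fin N → Fin n → ℝ) (v : Fin n → ℝ) :
    v ⬝ᵥ (empiricalCov x).mulVec v = (N : ℝ)⁻¹ * ∑ i, (v ⬝ᵥ x i) ^ 2 := by
  simp only [empiricalCov, Matrix.smul_mulVec, Matrix.sum_mulVec, dotProduct_smul, dotProduct_sum,
    dotProduct_vecMulVec_mulVec, smul_eq_mul]

lemma empiricalCov_transpose (x : Fin N → Fin n → ℝ) :
    (empiricalCov x).transpose = empiricalCov x := by
  simp [empiricalCov, Matrix.transpose_sum, Matrix.transpose_vecMulVec]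

/-- The columns of `1 - Q` lie in the kernel of `S`, and `E (aᵀw)² = aᵀSa` vanishes for `a` in that
kernel. -/
lemma ae_sqrt_mulVec_invSqrt_mulVec {w : Ω₀ → Fin n → ℝ}
    (hw2 : ∀ i, MemLp (fun ω => w ω i) 2 P₀) :
    ∀ᵐ ω ∂P₀, (cfc Real.sqrt (secondMoment w P₀) * invSqrt (secondMoment w P₀)).mulVec (w ω)
      = w ω := by
  set S := secondMoment w P₀
  set Q := cfc Real.sqrt S * invSqrt S
  have hS : S.PosSemidef := secondMoment_posSemidef hw2
  have hQ : Q.transpose = Q := by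
    simp only [Q]
    rw [Matrix.transpose_mul, cfc_transpose, sqrt_mul_invSqrt_comm]
    congr 1
    exact cfc_transpose _
  have h : ∀ j, ∀ᵐ ω ∂P₀, (1 - Q).mulVec (Pi.single j 1) ⬝ᵥ w ω = 0 := fun j =>
    ae_dotProduct_eq_zero hw2 (by
      rw [Matrix.mulVec_mulVec, Matrix.mul_sub, Matrix.mul_one]
      change (S - S * Q).mulVec _ = 0
      rw [mul_sqrt_mul_invSqrt hS, sub_self, Matrix.zero_mulVec])
  filter_upwards [ae_all_iff.2 h] with ω hω
  funext j
  have h1 := hω j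
  rw [dotProduct_comm, dotProduct_mulVec_comm_of_symm
    (by rw [Matrix.transpose_sub, Matrix.transpose_one, hQ]), Matrix.sub_mulVec,
    Matrix.one_mulVec, single_dotProduct, one_mul, Pi.sub_apply] at h1
  linarith

/-- Control of the whitened deviation on an `ε`-net yields the Loewner bound. -/
lemma le_smul_empiricalCov_of_net {S : Matrix (Fin n) (Fin n) ℝ} (hS : S.PosSemidef) {ε : ℝ}
    (hε : 0 < ε) (hε' : ε < 1 / 2) {s : Finset (Fin n → ℝ)} (hs : ∀ u ∈ s, u ⬝ᵥ u = 1)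
    (hnet : ∀ x : Fin n → ℝ, x ⬝ᵥ x = 1 → ∃ u ∈ s, (x - u) ⬝ᵥ (x - u) ≤ ε ^ 2)
    {x : Fin N → Fin n → ℝ}
    (hx : ∀ i, (cfc Real.sqrt S * invSqrt S).mulVec (x i) = x i) {m : ℝ}
    (hm : ∀ u ∈ s, |u ⬝ᵥ (invSqrt S * S * invSqrt S).mulVec u -
      (N : ℝ)⁻¹ * ∑ i, (u ⬝ᵥ (invSqrt S).mulVec (x i)) ^ 2| ≤ m)
    (hm1 : m / (1 - 2 * ε) < 1) :
    S ≤ (1 / (1 - m / (1 - 2 * ε))) • empiricalCov x := by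
  set R := cfc Real.sqrt S
  set A := invSqrt S
  have hRt : R.transpose = R := cfc_transpose _
  have hAt : A.transpose = A := cfc_transpose _
  have hSt : S.transpose = S := transpose_eq_of_posSemidef hS
  set D := A * S * A - empiricalCov fun i => A.mulVec (x i)
  have hD : D.transpose = D := by
    simp only [D]
    rw [Matrix.transpose_sub, empiricalCov_transpose, Matrix.transpose_mul, Matrix.transpose_mul,
      hAt, hSt, Matrix.mul_assoc]
  have hDq : ∀ u, u ⬝ᵥ D.mulVec u =
      u ⬝ᵥ (A * S * A).mulVec u - (N : ℝ)⁻¹ * ∑ i, (u ⬝ᵥ A.mulVec (x i)) ^ 2 := fun u => by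
    simp only [D]
    rw [Matrix.sub_mulVec, dotProduct_sub, dotProduct_empiricalCov_mulVec]
  have hpos : 0 < 1 - m / (1 - 2 * ε) := by linarith
  rw [Matrix.le_iff]
  refine Matrix.PosSemidef.of_dotProduct_mulVec_nonneg ?_ fun v => ?_
  · rw [Matrix.IsHermitian, Matrix.conjTranspose_eq_transpose_of_trivial, Matrix.transpose_sub,
      Matrix.transpose_smul, empiricalCov_transpose, hSt]
  -- At `R v`, the factors `R` undo the whitening: `R A x i = x i` and `R A S A R = S`, while `(R
  -- v)ᵀ(R v) = vᵀSv`.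
  have key := abs_quadratic_le_of_net hD hε hε' hs hnet
    (fun u hu => by rw [hDq]; exact hm u hu) (R.mulVec v)
  have hR : ∀ z, R.mulVec v ⬝ᵥ z = v ⬝ᵥ R.mulVec z := fun z => by
    rw [dotProduct_comm, dotProduct_mulVec_comm_of_symm hRt]
  rw [hDq] at key
  simp only [hR, Matrix.mulVec_mulVec] at key
  rw [sqrt_mul_sqrt_cfc hS] at key
  simp only [hx, ← Matrix.mul_assoc] at key
  have hRR : R * A * S * A * R = S := by
    have := sqrt_conj_invSqrt_conj hS
    simpa only [Matrix.mul_assoc] using this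
  rw [hRR] at key
  rw [star_trivial, Matrix.sub_mulVec, dotProduct_sub, Matrix.smul_mulVec, dotProduct_smul,
    dotProduct_empiricalCov_mulVec, smul_eq_mul, sub_nonneg, one_div, inv_mul_eq_div,
    le_div_iff₀ hpos]
  have := (abs_le.1 key).2
  linarith

end Whitening

end SubGaussianCovariance

/-! ### The union bound -/

theorem proposition1
    {Ω₀ Ω : Type*} [MeasurableSpace Ω₀] [MeasurableSpace Ω]
    (P₀ : Measure Ω₀) [IsProbabilityMeasure P₀] (P : Measure Ω) [IsProbabilityMeasure P]
    {n N : ℕ}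
    (w : Ω₀ → Fin n → ℝ) (S : Matrix (Fin n) (Fin n) ℝ) (σ : ℝ≥0)
    (hw2 : ∀ i, MemLp (fun ω => w ω i) 2 P₀)
    (hw0 : ∀ i, ∫ ω, w ω i ∂P₀ = 0)
    (hS : SubGaussianCovariance.secondMoment w P₀ = S)
    (hsub : SubGaussianCovariance.IsSubGVec
      (fun ω => (SubGaussianCovariance.invSqrt S).mulVec (w ω)) (σ ^ 2) P₀)
    (x : Fin N → Ω → Fin n → ℝ)
    (hindep : iIndepFun x P)
    (hident : ∀ i, IdentDistrib (x i) w P P₀)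
    (ε β : ℝ) (hε : ε ∈ Set.Ioo (0 : ℝ) (1 / 2)) (hβ : β ∈ Set.Ioo (0 : ℝ) 1)
    (hN : ⌈SubGaussianCovariance.sampleBound (SubGaussianCovariance.c₁ σ ε)
      (SubGaussianCovariance.c₂ (β / 2) ε n)⌉₊ ≤ N)
    (hN' : (N : ℝ) ≠ SubGaussianCovariance.sampleBound (SubGaussianCovariance.c₁ σ ε)
      (SubGaussianCovariance.c₂ (β / 2) ε n)) :
    SubGaussianCovariance.γ σ ε n N (β / 2) < 1 ∧
      1 - β ≤ P.real {ω | S ≤ (1 / (1 - SubGaussianCovariance.γ σ ε n N (β / 2))) •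
        SubGaussianCovariance.empiricalCov (fun i => x i ω)} := by
  open SubGaussianCovariance in
  obtain ⟨hε0, hε1⟩ := hε
  have hε2 : 0 < 1 - 2 * ε := by linarith
  have hc1 : 0 ≤ c₁ σ ε := by unfold c₁; positivity
  have hc2 : 0 < c₂ (β / 2) ε n := c₂_pos ⟨by linarith [hβ.1], by linarith [hβ.2]⟩ hε0 n
  have hlt : sampleBound (c₁ σ ε) (c₂ (β / 2) ε n) < N :=
    lt_of_le_of_ne (Nat.ceil_le.1 hN) hN'.symm
  have hNR : (0 : ℝ) < N := lt_of_le_of_lt (by unfold sampleBound; positivity) hlt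
  have hNpos : 0 < N := by exact_mod_cast hNR
  have hγ : γ σ ε n N (β / 2) < 1 := deviation_lt_one_of_sampleBound_lt hc1 hc2 hNR hlt
  refine ⟨hγ, ?_⟩
  subst hS
  set S := secondMoment w P₀
  have hSp : S.PosSemidef := secondMoment_posSemidef hw2
  set t := c₂ (β / 2) ε n
  set m := (σ : ℝ) ^ 2 * (Real.sqrt (32 * t / N) + 2 * t / N)
  have hγm : γ σ ε n N (β / 2) = m / (1 - 2 * ε) := by
    simp only [γ, c₁, m, t]; ring
  obtain ⟨s, hs, hcard, hnet⟩ := exists_dotProduct_net n hε0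
  have hAt : (invSqrt S).transpose = invSqrt S := cfc_transpose _
  let bad : (Fin n → ℝ) → Set Ω := fun u => {ω | m <
    |u ⬝ᵥ (invSqrt S * S * invSqrt S).mulVec u -
      (N : ℝ)⁻¹ * ∑ i, (u ⬝ᵥ (invSqrt S).mulVec (x i ω)) ^ 2|}
  have hbad : ∀ u ∈ s, P.real (bad u) ≤ 2 * Real.exp (-t) := by
    intro u hu
    have hmeas : Measurable fun v : Fin n → ℝ => u ⬝ᵥ (invSqrt S).mulVec v := by
      unfold Matrix.mulVec dotProduct; fun_prop
    have hid : ∀ i, IdentDistrib (fun ω => u ⬝ᵥ (invSqrt S).mulVec (x i ω))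
        (fun ω => u ⬝ᵥ (invSqrt S).mulVec (w ω)) P P₀ := fun i => (hident i).comp hmeas
    have := measure_sq_deviation_le hNpos
      (X := fun i ω => u ⬝ᵥ (invSqrt S).mulVec (x i ω)) (s := σ ^ 2)
      (hindep.comp _ fun _ => hmeas)
      (fun i => hasSubgaussianMGF_of_identDistrib (hid i) (hsub u (hs u hu)).2)
      (m := u ⬝ᵥ (invSqrt S * S * invSqrt S).mulVec u)
      (fun i => by
        have hsq := ((hid i).comp (u := fun y : ℝ => y ^ 2) (by fun_prop)).integral_eq
        simp only [Function.comp_def] at hsq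
        rw [hsq]
        simp only [dotProduct_mulVec_comm_of_symm hAt u, dotProduct_comm (w _)]
        rw [integral_dotProduct_sq hw2, ← Matrix.mulVec_mulVec, ← Matrix.mulVec_mulVec,
          dotProduct_mulVec_comm_of_symm hAt u, dotProduct_comm])
      hc2.le
    simpa only [NNReal.coe_pow] using this
  -- Lying in the range of `S` depends only on the law, so it passes from `w` to the samples.
  have hrange : ∀ᵐ ω ∂P, ∀ i, (cfc Real.sqrt S * invSqrt S).mulVec (x i ω) = x i ω := by
    refine ae_all_iff.2 fun i => (hident i).symm.ae_snd (p := fun v =>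
      (cfc Real.sqrt S * invSqrt S).mulVec v = v) ?_ (ae_sqrt_mulVec_invSqrt_mulVec hw2)
    exact measurableSet_eq_fun (by unfold Matrix.mulVec dotProduct; fun_prop) measurable_id
  -- `exp (-t) = (1 + 2/ε)^(-n) · β/4`, so the two-sided union bound loses only `β/2`, half of what
  -- is allowed.
  have hunion : P.real (⋃ u ∈ s, bad u) ≤ β / 2 := by
    calc P.real (⋃ u ∈ s, bad u) ≤ ∑ u ∈ s, P.real (bad u) := measureReal_biUnion_finset_le _ _
      _ ≤ ∑ _u ∈ s, 2 * Real.exp (-t) := Finset.sum_le_sum hbad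
      _ = s.card * (2 * Real.exp (-t)) := by simp
      _ ≤ (1 + 2 / ε) ^ n * (2 * Real.exp (-t)) := by gcongr
      _ = β / 2 := by
        have hβ' : 0 < β := hβ.1
        have hpos : 0 < 1 + 2 / ε := by positivity
        simp only [t, c₂]
        rw [neg_add, Real.exp_add, Real.exp_neg, Real.exp_nat_mul, Real.exp_log hpos,
          Real.exp_neg, Real.exp_log (by positivity)]
        field_simp
  set good : Set Ω := {ω | S ≤ (1 / (1 - γ σ ε n N (β / 2))) • empiricalCov fun i => x i ω}
  have hcover : ∀ᵐ ω ∂P, ω ∈ good ∪ ⋃ u ∈ s, bad u := by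
    filter_upwards [hrange] with ω hω
    by_cases h : ω ∈ ⋃ u ∈ s, bad u
    · exact Or.inr h
    · left
      simp only [Set.mem_iUnion, not_exists] at h
      change S ≤ _
      rw [hγm]
      exact le_smul_empiricalCov_of_net hSp hε0 hε1 hs hnet hω
        (fun u hu => not_lt.1 (h u hu)) (hγm ▸ hγ)
  -- Subadditivity on an almost sure cover needs no measurability of `good`.
  have h1 : P.real (good ∪ ⋃ u ∈ s, bad u) = 1 := by
    have h : (good ∪ ⋃ u ∈ s, bad u : Set Ω) =ᵐ[P] Set.univ := Filter.eventuallyEq_univ.2 hcover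
    rw [measureReal_congr h, probReal_univ]
  have h2 := measureReal_union_le (μ := P) good (⋃ u ∈ s, bad u)
  have := hβ.1
  linarith
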